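/- Theorem (Montel's theorem in $\mathbb C^n$). Let $\Omega\subseteq\mathbb C^n$ be open, let $a\neq b$ be two complex numbers, and let $\mathcal F$ be a family of holomorphic functions on $\Omega$ such that $f(z)\neq a$ and $f(z)\neq b$ for all $f\in\mathcal F$ and all $z\in\Omega$. Then every sequence in $\mathcal F$ has a subsequence $(f_j)$ that converges uniformly on compact subsets of $\Omega$, with respect to the chordal metric $$s(w,w')=\frac{|w-w'|}{\sqrt{1+|w|^2}\,\sqrt{1+|w'|^2}},\qquad s(w,\infty)=s(\infty,w)=\frac1{\sqrt{1+|w|^2}},\qquad s(\infty,\infty)=0,$$ to a function $g:\Omega\to\mathbb C\cup\{\infty\}$. Moreover, on each connected component $C$ of $\Omega$, either $g\equiv\infty$, or $g$ is finite-valued and holomorphic and $f_j\to g$ uniformly on compact subsets of $C$ in the usual (Euclidean) sense. -/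

import Mathlib

open Filter Topology

/-- The chordal distance on the Riemann sphere `ℂ ∪ {∞}`, normalised to have diameter `1`:
`s(a, b) = |a - b| / (√(1 + |a|²) √(1 + |b|²))` and `s(a, ∞) = 1 / √(1 + |a|²)`. -/
noncomputable def chordalDist : OnePoint ℂ → OnePoint ℂ → ℝ
  | some a, some b => ‖a - b‖ / (Real.sqrt (1 + ‖a‖ ^ 2) * Real.sqrt (1 + ‖b‖ ^ 2))
  | some a, none => 1 / Real.sqrt (1 + ‖a‖ ^ 2)
  | none, some b => 1 / Real.sqrt (1 + ‖b‖ ^ 2)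
  | none, none => 0

theorem chordalDist_coe_coe (a b : ℂ) : chordalDist (a : OnePoint ℂ) (b : OnePoint ℂ) =
    ‖a - b‖ / (Real.sqrt (1 + ‖a‖ ^ 2) * Real.sqrt (1 + ‖b‖ ^ 2)) := rfl

theorem chordalDist_coe_infty (a : ℂ) : chordalDist (a : OnePoint ℂ) OnePoint.infty =
    1 / Real.sqrt (1 + ‖a‖ ^ 2) := rfl

theorem chordalDist_infty_coe (b : ℂ) : chordalDist OnePoint.infty (b : OnePoint ℂ) =
    1 / Real.sqrt (1 + ‖b‖ ^ 2) := rfl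

theorem chordalDist_infty_infty : chordalDist OnePoint.infty OnePoint.infty = 0 := rfl

/-- The complex-valued functions `u j` converge to the sphere-valued function `g`, uniformly on
every compact subset of `Ω` with respect to the chordal distance. -/
def ChordallyTendstoOnCompacts {X : Type*} [TopologicalSpace X] (Ω : Set X)
    (u : ℕ → X → ℂ) (g : X → OnePoint ℂ) : Prop :=
  ∀ K : Set X, K ⊆ Ω → IsCompact K → ∀ ε : ℝ, 0 < ε →
    ∀ᶠ j in atTop, ∀ z ∈ K, chordalDist (u j z : OnePoint ℂ) (g z) < ε

/-! The core is Schottky's theorem: on a ball, omitting `a` and `b` and having a bounded value at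
the centre forces a uniform bound on the half ball. After normalising the omitted values to ±1 and
restricting to complex lines, write f = cosh(πi cosh g) on the unit disc. Since f ≠ ±1, g misses
every point where cosh is an integer. These points form a net in the plane, so Bloch's theorem
bounds g', and hence f.

A diagonal subsequence converges in ℂ ∪ {∞} at every point of a countable dense set. By Schottky,
each point of Ω has a ball on which this subsequence is either eventually bounded or tends uniformly
to ∞. The two kinds of points form disjoint open sets covering Ω, so each component lies in one of
them. On the bounded part, Schwarz's lemma gives equicontinuity, hence locally uniform convergence
to a holomorphic limit. -/

/-! ### Holomorphic logarithms and inverse hyperbolic cosines -/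

open Metric Set in
/-- A nonvanishing holomorphic function on a disc has a holomorphic logarithm. -/
theorem DifferentiableOn.exists_exp_eq_on_ball {f : ℂ → ℂ} {c : ℂ} {r : ℝ}
    (hf : DifferentiableOn ℂ f (ball c r)) (h0 : ∀ z ∈ ball c r, f z ≠ 0) :
    ∃ g : ℂ → ℂ, DifferentiableOn ℂ g (ball c r) ∧ (∀ z ∈ ball c r, Complex.exp (g z) = f z) ∧
      g c = Complex.log (f c) := by
  rcases le_or_gt r 0 with hr | hr
  · exact ⟨fun _ => Complex.log (f c), by simp [ball_eq_empty.2 hr]⟩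
  obtain ⟨g, hgc, hg⟩ := Complex.IsExactOn.with_val_at
    ((hf.deriv isOpen_ball).div hf h0).isExactOn_ball c (Complex.log (f c))
  have hc : c ∈ ball c r := mem_ball_self hr
  refine ⟨g, fun z hz => (hg z hz).differentiableAt.differentiableWithinAt, ?_, hgc⟩
  have hder : ∀ z ∈ ball c r, HasDerivAt (fun z => f z * Complex.exp (-g z)) 0 z := by
    intro z hz
    have hgz : HasDerivAt g (_root_.deriv f z / f z) z := hg z hz
    refine ((hf.differentiableAt (isOpen_ball.mem_nhds hz)).hasDerivAt.mul
      hgz.neg.cexp).congr_deriv ?_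
    have := h0 z hz
    field_simp
    simp
  intro z hz
  have hconst : f z * Complex.exp (-g z) = f c * Complex.exp (-g c) :=
    isOpen_ball.is_const_of_deriv_eq_zero (convex_ball c r).isPreconnected
      (fun z hz => (hder z hz).differentiableAt.differentiableWithinAt)
      (fun z hz => (hder z hz).deriv) hz hc
  rw [hgc, Complex.exp_neg, Complex.exp_neg, Complex.exp_log (h0 c hc),
    mul_inv_cancel₀ (h0 c hc)] at hconst
  have := Complex.exp_ne_zero (g z)
  field_simp at hconst
  exact hconst.symm

/-- With x = Re z, the triangle inequality gives |cosh z| ≥ |sinh x| ≥ |x|. This controls an inverse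
hyperbolic cosine at the centre of the disc. -/
theorem Complex.abs_re_le_norm_cosh (z : ℂ) : |z.re| ≤ ‖Complex.cosh z‖ := by
  have h1 : |Real.exp z.re - Real.exp (-z.re)| ≤ 2 * ‖Complex.cosh z‖ := by
    have h := abs_norm_sub_norm_le (Complex.exp z) (-Complex.exp (-z))
    rw [norm_neg, Complex.norm_exp, Complex.norm_exp, Complex.neg_re, sub_neg_eq_add] at h
    refine h.trans_eq ?_
    rw [Complex.cosh, norm_div]
    simp
    ring
  have h2 : |z.re| ≤ |Real.sinh z.re| := by
    rcases le_total 0 z.re with h | h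
    · exact abs_le_abs_of_nonneg h (Real.self_le_sinh_iff.2 h)
    · exact abs_le_abs_of_nonpos h (Real.sinh_le_self_iff.2 h)
  rw [Real.sinh_eq, abs_div, abs_two] at h2
  linarith

theorem Complex.norm_cosh_le_exp_norm (z : ℂ) : ‖Complex.cosh z‖ ≤ Real.exp ‖z‖ := by
  have h1 := Complex.norm_exp_le_exp_norm z
  have h2 := Complex.norm_exp_le_exp_norm (-z)
  rw [norm_neg] at h2
  have h3 := norm_add_le (Complex.exp z) (Complex.exp (-z))
  rw [Complex.cosh, norm_div, Complex.norm_two]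
  linarith

open Metric Set in
/-- A holomorphic function on a disc that omits `1` and `-1` is a hyperbolic cosine. -/
theorem DifferentiableOn.exists_cosh_eq_on_ball {f : ℂ → ℂ} {c : ℂ} {r : ℝ} (hr : 0 < r)
    (hf : DifferentiableOn ℂ f (ball c r)) (h1 : ∀ z ∈ ball c r, f z ≠ 1)
    (h2 : ∀ z ∈ ball c r, f z ≠ -1) :
    ∃ g : ℂ → ℂ, DifferentiableOn ℂ g (ball c r) ∧ (∀ z ∈ ball c r, Complex.cosh (g z) = f z) ∧
      ‖g c‖ ≤ Real.pi + ‖f c‖ := by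
  -- Here s = exp(l/2) is a square root of f² - 1. As (f + s)(f - s) = 1, the function f + s has a
  -- logarithm g, and cosh g = f.
  obtain ⟨l, hl, hle, -⟩ := ((hf.pow 2).sub_const 1).exists_exp_eq_on_ball (fun z hz h => by
    have : (f z - 1) * (f z + 1) = 0 := by simp only [Pi.pow_apply] at h; linear_combination h
    rcases mul_eq_zero.1 this with h | h
    · exact h1 z hz (by linear_combination h)
    · exact h2 z hz (by linear_combination h))
  have hs : ∀ z ∈ ball c r, (f z + Complex.exp (l z / 2)) * (f z - Complex.exp (l z / 2)) = 1 := by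
    intro z hz
    have : Complex.exp (l z / 2) ^ 2 = f z ^ 2 - 1 := by
      rw [← Complex.exp_nat_mul]
      rw [← Pi.pow_apply, ← hle z hz]
      congr 1
      push_cast
      ring
    linear_combination -this
  obtain ⟨g, hg, hge, hgc⟩ := (hf.add (hl.div_const 2).cexp).exists_exp_eq_on_ball
    (fun z hz => left_ne_zero_of_mul_eq_one (hs z hz))
  have hcosh : ∀ z ∈ ball c r, Complex.cosh (g z) = f z := by
    intro z hz
    have e1 : Complex.exp (-g z) = f z - Complex.exp (l z / 2) := by
      rw [Complex.exp_neg, hge z hz]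
      exact inv_eq_of_mul_eq_one_right (hs z hz)
    rw [Complex.cosh, e1, hge z hz]
    simp only [Pi.add_apply]
    ring
  refine ⟨g, hg, hcosh, ?_⟩
  have e1 : |(g c).im| ≤ Real.pi := by
    rw [hgc, Complex.log_im]
    exact Complex.abs_arg_le_pi _
  have e2 := Complex.abs_re_le_norm_cosh (g c)
  rw [hcosh c (mem_ball_self hr)] at e2
  linarith [Complex.norm_le_abs_re_add_abs_im (g c)]

/-! ### Bloch's theorem -/

open Metric Set in
/-- If the derivative of `f` on a disc is bounded by twice its modulus at the centre, then the image
of the disc contains a disc of comparable size. -/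
theorem Complex.ball_subset_image_of_norm_deriv_le {f : ℂ → ℂ} {p : ℂ} {t : ℝ}
    (ht : 0 < t) (hf : DifferentiableOn ℂ f (ball p t)) (hp : deriv f p ≠ 0)
    (hd : ∀ z ∈ ball p t, ‖deriv f z‖ ≤ 2 * ‖deriv f p‖) :
    ball (f p) (t * ‖deriv f p‖ / 24) ⊆ f '' ball p t := by
  set A := ‖deriv f p‖ with hA
  have hApos : 0 < A := norm_pos_iff.2 hp
  have hsub : closedBall p (t / 6) ⊆ ball p t := closedBall_subset_ball (by linarith)
  -- Schwarz's lemma for f' - f'(p), which is bounded by 3A on the disc of radius t.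
  have hdist : ∀ z ∈ closedBall p (t / 6), ‖deriv f z - deriv f p‖ ≤ A / 2 := by
    intro z hz
    have h := Complex.dist_le_div_mul_dist_of_mapsTo_ball (R₂ := 3 * A) (hf.deriv isOpen_ball)
      (fun w hw => by
        rw [mem_closedBall, dist_eq_norm]
        linarith [norm_sub_le (deriv f w) (deriv f p), hd w hw]) (hsub hz)
    rw [dist_eq_norm] at h
    have hz' : dist z p ≤ t / 6 := hz
    calc _ ≤ 3 * A / t * dist z p := h
      _ ≤ 3 * A / t * (t / 6) := by gcongr
      _ = A / 2 := by field_simp; norm_num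
  -- The linear part contributes At/6 and the error is at most (A/2)(t/6). The quantitative open
  -- mapping theorem then halves At/12.
  have hlow : ∀ z ∈ sphere p (t / 6), A * t / 12 ≤ ‖f z - f p‖ := by
    intro z hz
    have hz' : ‖z - p‖ = t / 6 := by rw [← dist_eq_norm]; exact hz
    have h := (convex_closedBall p (t / 6)).norm_image_sub_le_of_norm_hasDerivWithin_le
      (f := fun w => f w - deriv f p * w) (f' := fun w => deriv f w - deriv f p) (C := A / 2)
      (fun w hw => ((((hf.differentiableAt (isOpen_ball.mem_nhds (hsub hw))).hasDerivAt).sub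
        (by simpa using (hasDerivAt_id w).const_mul (deriv f p)))).hasDerivWithinAt)
      hdist (mem_closedBall_self (by positivity)) (sphere_subset_closedBall hz)
    have h3 : ‖deriv f p * (z - p)‖ = A * (t / 6) := by rw [norm_mul, hz']
    have h4 := norm_sub_norm_le (deriv f p * (z - p)) (-(f z - deriv f p * z - (f p - deriv f p * p)))
    rw [norm_neg, show deriv f p * (z - p) - -(f z - deriv f p * z - (f p - deriv f p * p))
      = f z - f p by ring] at h4
    rw [hz'] at h
    nlinarith
  have hcl : DiffContOnCl ℂ f (ball p (t / 6)) :=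
    hf.diffContOnCl_ball hsub
  have hfreq : ∃ᶠ z in 𝓝 p, f z ≠ f p := by
    have hev := (hf.differentiableAt (ball_mem_nhds p ht)).hasDerivAt.eventually_ne (c := f p) hp
    exact hev.frequently.filter_mono nhdsWithin_le_nhds
  have h := hcl.ball_subset_image_closedBall (by positivity) hlow hfreq
  rw [show A * t / 12 / 2 = t * A / 24 by ring] at h
  exact h.trans (image_mono hsub)

open Metric Set in
/-- **Bloch's theorem**, with a constant that is not optimal. -/
theorem Complex.exists_ball_subset_image {f : ℂ → ℂ} {c : ℂ} {r R : ℝ}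
    (hr : 0 < r) (hrR : r < R) (hf : DifferentiableOn ℂ f (ball c R)) :
    ∃ w, ball w (r * ‖deriv f c‖ / 48) ⊆ f '' ball c R := by
  rcases eq_or_ne (deriv f c) 0 with h0 | h0
  · exact ⟨0, by simp [h0]⟩
  have hsub : closedBall c r ⊆ ball c R := closedBall_subset_ball hrR
  -- Maximality of this weight gives |f'| ≤ 2|f'(p)| within t of p, where t is half the distance
  -- from p to the circle of radius r. It also gives t|f'(p)| ≥ r|f'(c)|/2, whence 48 = 2 · 24.
  obtain ⟨p, hp, hmax⟩ := (isCompact_closedBall c r).exists_isMaxOn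
    ⟨c, mem_closedBall_self hr.le⟩ (f := fun z => ‖deriv f z‖ * (r - dist z c))
    (((hf.deriv isOpen_ball).continuousOn.mono hsub).norm.mul (by fun_prop))
  have hmax' : ∀ z ∈ closedBall c r,
      ‖deriv f z‖ * (r - dist z c) ≤ ‖deriv f p‖ * (r - dist p c) := fun z hz => hmax hz
  have hc := hmax' c (mem_closedBall_self hr.le)
  rw [dist_self, sub_zero] at hc
  have hpos : 0 < ‖deriv f p‖ * (r - dist p c) :=
    lt_of_lt_of_le (mul_pos (norm_pos_iff.2 h0) hr) hc
  have hp0 : deriv f p ≠ 0 := fun h => by simp [h] at hpos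
  have hpd : 0 < r - dist p c := pos_of_mul_pos_right hpos (norm_nonneg _)
  set t := (r - dist p c) / 2 with ht
  have htpos : 0 < t := by positivity
  have hz : ∀ z ∈ ball p t, t ≤ r - dist z c := by
    intro z hz
    have := dist_triangle z p c
    rw [mem_ball] at hz
    linarith
  have hball : ball p t ⊆ closedBall c r := fun z hz' => by
    rw [mem_closedBall]; linarith [hz z hz']
  have h := Complex.ball_subset_image_of_norm_deriv_le htpos (hf.mono (hball.trans hsub)) hp0 (by
    intro z hz'
    have h1 := hmax' z (hball hz')
    have h2 : ‖deriv f z‖ * t ≤ ‖deriv f z‖ * (r - dist z c) := by gcongr; exact hz z hz'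
    have h3 : r - dist p c = 2 * t := by rw [ht]; ring
    rw [h3] at h1
    exact le_of_mul_le_mul_right (by linarith) htpos)
  refine ⟨f p, (ball_subset_ball ?_).trans (h.trans (image_mono (hball.trans hsub)))⟩
  rw [ht]
  linarith

/-! ### Schottky's theorem -/

/-- The points at which the hyperbolic cosine is an integer form a `9`-net of the plane. -/
theorem Complex.exists_cosh_eq_int_of_dist_lt (w : ℂ) :
    ∃ v : ℂ, dist v w < 9 ∧ ∃ m : ℤ, Complex.cosh v = m := by
  have key : ∀ x : ℝ, 0 ≤ x → ∃ y : ℝ, |y - x| ≤ 2 ∧ ∃ m : ℤ, Real.cosh y = m := by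
    intro x hx
    have h1 : (1 : ℝ) ≤ (⌈Real.cosh x⌉ : ℤ) := (Real.one_le_cosh x).trans (Int.le_ceil _)
    refine ⟨Real.arcosh (⌈Real.cosh x⌉ : ℤ), ?_, ⌈Real.cosh x⌉, Real.cosh_arcosh h1⟩
    set y := Real.arcosh (⌈Real.cosh x⌉ : ℤ) with hy
    have hy0 : 0 ≤ y := Real.arcosh_nonneg h1
    have hcy : Real.cosh y = (⌈Real.cosh x⌉ : ℤ) := Real.cosh_arcosh h1
    have hxy : x ≤ y := by
      have : Real.cosh x ≤ Real.cosh y := hcy ▸ Int.le_ceil _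
      rwa [Real.cosh_le_cosh, abs_of_nonneg hx, abs_of_nonneg hy0] at this
    have hyx : y ≤ x + 2 := by
      -- cosh(x + 2) ≥ cosh x cosh 2 ≥ 2 cosh x ≥ cosh x + 1, which exceeds the ceiling.
      have h2 : Real.cosh y ≤ Real.cosh (x + 2) := by
        have e1 := Int.ceil_lt_add_one (Real.cosh x)
        have e2 : 2 ≤ Real.cosh 2 := by
          have := Real.add_one_le_exp (1 : ℝ)
          have e : Real.exp 2 = Real.exp 1 * Real.exp 1 := by rw [← Real.exp_add]; norm_num
          rw [Real.cosh_eq]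
          nlinarith [Real.exp_pos (-2)]
        have e3 := Real.sinh_nonneg_iff.2 hx
        have e4 : 0 ≤ Real.sinh 2 := Real.sinh_nonneg_iff.2 (by norm_num)
        have e5 := Real.one_le_cosh x
        rw [hcy, Real.cosh_add]
        nlinarith [mul_nonneg e3 e4]
      rwa [Real.cosh_le_cosh, abs_of_nonneg hy0, abs_of_nonneg (by linarith)] at h2
    rw [abs_le]
    constructor <;> linarith
  have key' : ∃ y : ℝ, |y - w.re| ≤ 2 ∧ ∃ m : ℤ, Real.cosh y = m := by
    rcases le_total 0 w.re with h | h
    · exact key _ h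
    · obtain ⟨y, hy, m, hm⟩ := key (-w.re) (by linarith)
      refine ⟨-y, ?_, m, by rwa [Real.cosh_neg]⟩
      rwa [← abs_neg, show -(-y - w.re) = y - -w.re by ring]
  obtain ⟨y, hy, m, hm⟩ := key'
  set k : ℤ := round (w.im / (2 * Real.pi)) with hk
  refine ⟨y + k * (2 * Real.pi * Complex.I), ?_, m, ?_⟩
  · have him : |k * (2 * Real.pi) - w.im| ≤ Real.pi := by
      have h := abs_sub_round (w.im / (2 * Real.pi))
      rw [← hk] at h
      have hpi := Real.pi_pos
      have e : w.im - k * (2 * Real.pi) = (w.im / (2 * Real.pi) - k) * (2 * Real.pi) := by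
        field_simp
      rw [abs_sub_comm, e, abs_mul, abs_of_pos (by positivity : 0 < 2 * Real.pi)]
      nlinarith
    rw [dist_eq_norm]
    refine (Complex.norm_le_abs_re_add_abs_im _).trans_lt ?_
    have e1 : ((y + k * (2 * Real.pi * Complex.I) : ℂ) - w).re = y - w.re := by simp
    have e2 : ((y + k * (2 * Real.pi * Complex.I) : ℂ) - w).im = k * (2 * Real.pi) - w.im := by
      simp
    rw [e1, e2]
    linarith [Real.pi_lt_four]
  · rw [Complex.cosh, neg_add, ← neg_mul, ← Int.cast_neg, Complex.exp_add, Complex.exp_add,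
      Complex.exp_int_mul_two_pi_mul_I, Complex.exp_int_mul_two_pi_mul_I, mul_one, mul_one,
      ← Complex.cosh, ← Complex.ofReal_cosh, hm]
    simp

open Metric Set in
/-- **Schottky's theorem** for functions that omit `1` and `-1`. -/
theorem exists_norm_le_of_ne_one_of_ne_neg_one (R : ℝ) :
    ∃ M : ℝ, ∀ f : ℂ → ℂ, DifferentiableOn ℂ f (ball 0 1) → (∀ z ∈ ball (0 : ℂ) 1, f z ≠ 1) →
      (∀ z ∈ ball (0 : ℂ) 1, f z ≠ -1) → ‖f 0‖ ≤ R → ∀ z ∈ ball (0 : ℂ) (1 / 2), ‖f z‖ ≤ M := by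
  refine ⟨Real.exp (Real.pi * Real.exp (2 * Real.pi + R + 864)), fun f hf h1 h2 hR z hz => ?_⟩
  obtain ⟨k, hk, hkf, hk0⟩ := hf.exists_cosh_eq_on_ball one_pos h1 h2
  have hpi := Real.pi_pos
  have hpiI : (Real.pi * Complex.I : ℂ) ≠ 0 := by simp [hpi.ne']
  -- At k = πim one has f = cos(πm) = ±1, which is excluded.
  have hint : ∀ z ∈ ball (0 : ℂ) 1, ∀ m : ℤ, k z / (Real.pi * Complex.I) ≠ m := by
    intro z hz m h
    rw [div_eq_iff hpiI] at h
    have hc := hkf z hz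
    rw [h, ← mul_assoc, Complex.cosh_mul_I] at hc
    have : (f z - 1) * (f z + 1) = 0 := by
      have hs : Complex.sin (m * Real.pi) = 0 := Complex.sin_int_mul_pi m
      have := Complex.sin_sq_add_cos_sq (m * Real.pi)
      rw [hs, hc] at this
      linear_combination this
    rcases mul_eq_zero.1 this with h | h
    · exact h1 z hz (by linear_combination h)
    · exact h2 z hz (by linear_combination h)
  obtain ⟨g, hg, hgk, hg0⟩ := (hk.div_const (Real.pi * Complex.I)).exists_cosh_eq_on_ball one_pos
    (fun z hz => by simpa using hint z hz 1) (fun z hz => by simpa using hint z hz (-1))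
  have hnormk : ∀ z, ‖k z / (Real.pi * Complex.I)‖ = ‖k z‖ / Real.pi := by
    intro z
    simp [abs_of_pos hpi]
  have hg0' : ‖g 0‖ ≤ 2 * Real.pi + R := by
    rw [hnormk] at hg0
    have : ‖k 0‖ / Real.pi ≤ ‖k 0‖ :=
      div_le_self (norm_nonneg _) (by linarith [Real.pi_gt_three])
    linarith
  -- 1728 = 9 · 48 · 4: a larger derivative would give a Bloch disc of radius at least 9 in the
  -- image of g, and such a disc meets the net.
  have hder : ∀ z ∈ ball (0 : ℂ) (1 / 2), ‖deriv g z‖ ≤ 1728 := by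
    intro z hz
    have hsub : ball z (1 / 2) ⊆ ball 0 1 := ball_subset_ball' (by
      rw [mem_ball] at hz; linarith)
    obtain ⟨w, hw⟩ := Complex.exists_ball_subset_image (r := 1 / 4) (by norm_num)
      (by norm_num) (hg.mono hsub)
    by_contra! hlt
    obtain ⟨v, hv, m, hm⟩ := Complex.exists_cosh_eq_int_of_dist_lt w
    obtain ⟨y, hy, rfl⟩ := hw (show v ∈ ball w _ from lt_of_lt_of_le hv (by linarith))
    rw [hgk y (hsub hy)] at hm
    exact hint y (hsub hy) m hm
  have hsub : ball (0 : ℂ) (1 / 2) ⊆ ball 0 1 := ball_subset_ball (by norm_num)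
  have hgz : ‖g z‖ ≤ 2 * Real.pi + R + 864 := by
    have h := (convex_ball (0 : ℂ) (1 / 2)).norm_image_sub_le_of_norm_deriv_le
      (fun y hy => hg.differentiableAt (isOpen_ball.mem_nhds (hsub hy))) hder
      (mem_ball_self (by norm_num)) hz
    rw [mem_ball, dist_eq_norm] at hz
    linarith [norm_le_norm_add_norm_sub' (g z) (g 0)]
  have hkz : ‖k z‖ ≤ Real.pi * Real.exp (2 * Real.pi + R + 864) := by
    have h := Complex.norm_cosh_le_exp_norm (g z)
    rw [hgk z (hsub hz), hnormk, div_le_iff₀' hpi] at h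
    exact h.trans (by gcongr)
  rw [← hkf z (hsub hz)]
  exact (Complex.norm_cosh_le_exp_norm _).trans (Real.exp_le_exp.2 hkz)

open Metric Set in
/-- **Schottky's theorem** for functions on balls of a complex normed space. -/
theorem exists_norm_le_of_ne_of_ne {E : Type*} [NormedAddCommGroup E] [NormedSpace ℂ E]
    {a b : ℂ} (hab : a ≠ b) (R : ℝ) :
    ∃ M : ℝ, ∀ (x : E) (ρ : ℝ) (f : E → ℂ), DifferentiableOn ℂ f (ball x ρ) →
      (∀ z ∈ ball x ρ, f z ≠ a ∧ f z ≠ b) → ‖f x‖ ≤ R → ∀ z ∈ ball x (ρ / 2), ‖f z‖ ≤ M := by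
  have hba : b - a ≠ 0 := sub_ne_zero.2 hab.symm
  obtain ⟨M, hM⟩ := exists_norm_le_of_ne_one_of_ne_neg_one ((2 * R + ‖a + b‖) / ‖b - a‖)
  refine ⟨(M * ‖b - a‖ + ‖a + b‖) / 2, fun x ρ f hf h hR z hz => ?_⟩
  have hρ : 0 < ρ := by linarith [pos_of_mem_ball hz]
  rw [mem_ball, dist_eq_norm] at hz
  -- The complex line through x and z, scaled so that z has parameter ‖z - x‖ / ρ < 1/2. For z = x,
  -- division by zero makes v = 0.
  set v : E := ((ρ / ‖z - x‖ : ℝ) : ℂ) • (z - x) with hv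
  have hvn : ‖v‖ ≤ ρ := by
    rw [hv, norm_smul, Complex.norm_real, Real.norm_of_nonneg (by positivity)]
    rw [div_mul_comm]
    exact mul_le_of_le_one_left hρ.le (div_self_le_one _)
  have hmaps : MapsTo (fun t : ℂ => x + t • v) (ball 0 1) (ball x ρ) := by
    intro t ht
    rw [mem_ball_zero_iff] at ht
    rw [mem_ball, dist_eq_norm, add_sub_cancel_left, norm_smul]
    nlinarith [norm_nonneg v, norm_nonneg t]
  have hzv : x + ((‖z - x‖ / ρ : ℝ) : ℂ) • v = z := by
    rcases eq_or_ne (z - x) 0 with h0 | h0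
    · simp [hv, (sub_eq_zero.1 h0)]
    · have : ‖z - x‖ ≠ 0 := norm_ne_zero_iff.2 h0
      rw [hv, smul_smul, ← Complex.ofReal_mul,
        show ‖z - x‖ / ρ * (ρ / ‖z - x‖) = 1 by field_simp]
      simp
  have key := hM (fun t => (2 * f (x + t • v) - (a + b)) / (b - a))
    ((((hf.comp (by fun_prop) hmaps).const_mul 2).sub_const _).div_const _)
    (fun t ht he => by
      rw [div_eq_one_iff_eq hba] at he
      exact (h _ (hmaps ht)).2 (by linear_combination he / 2))
    (fun t ht he => by
      rw [div_eq_iff hba] at he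
      exact (h _ (hmaps ht)).1 (by linear_combination he / 2))
    (by
      rw [zero_smul, add_zero, norm_div]
      gcongr
      refine (norm_sub_le _ _).trans ?_
      rw [norm_mul, Complex.norm_two]
      gcongr)
    ((‖z - x‖ / ρ : ℝ) : ℂ) (by
      rw [mem_ball_zero_iff, Complex.norm_real, Real.norm_of_nonneg (by positivity),
        div_lt_iff₀ hρ]
      linarith)
  rw [hzv, norm_div, div_le_iff₀ (norm_pos_iff.2 hba)] at key
  have h2 := norm_sub_norm_le (2 * f z) (a + b)
  rw [norm_mul, Complex.norm_two] at h2
  linarith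

/-! ### Convergence of subsequences and holomorphy of limits -/

/-- Sequences of complex-valued functions on a countable set have a subsequence that converges at
each point to a complex number or to infinity. -/
theorem exists_subseq_tendsto_norm_atTop_or_tendsto {ι : Type*} [Countable ι] (v : ℕ → ι → ℂ) :
    ∃ φ : ℕ → ℕ, StrictMono φ ∧ ∀ i, Tendsto (fun j => ‖v (φ j) i‖) atTop atTop ∨
      ∃ l, Tendsto (fun j => v (φ j) i) atTop (𝓝 l) := by
  have hK : IsCompact (Set.pi Set.univ
      fun _ : ι => (Set.Icc (0 : ℝ) 1) ×ˢ (Metric.closedBall (0 : ℂ) 1)) :=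
    isCompact_univ_pi fun _ => isCompact_Icc.prod (isCompact_closedBall 0 1)
  -- The map w ↦ (1/(1+|w|), w/(1+|w|)) embeds ℂ in a compact set. A limit with first coordinate 0
  -- represents ∞.
  obtain ⟨q, -, φ, hφ, hlim⟩ := hK.tendsto_subseq
    (x := fun j i => ((1 + ‖v j i‖)⁻¹, (((1 + ‖v j i‖)⁻¹ : ℝ) : ℂ) * v j i)) (by
      intro j i _
      have h0 := norm_nonneg (v j i)
      refine ⟨⟨by positivity, inv_le_one_of_one_le₀ (by linarith)⟩, ?_⟩
      rw [mem_closedBall_zero_iff, norm_mul, Complex.norm_real,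
        Real.norm_of_nonneg (by positivity), inv_mul_le_iff₀ (by positivity)]
      linarith)
  refine ⟨φ, hφ, fun i => ?_⟩
  have hi := (tendsto_pi_nhds.1 hlim) i
  have h1 : Tendsto (fun j => (1 + ‖v (φ j) i‖)⁻¹) atTop (𝓝 (q i).1) :=
    (continuous_fst.tendsto _).comp hi
  have h2 : Tendsto (fun j => (((1 + ‖v (φ j) i‖)⁻¹ : ℝ) : ℂ) * v (φ j) i) atTop (𝓝 (q i).2) :=
    (continuous_snd.tendsto _).comp hi
  rcases eq_or_ne (q i).1 0 with h0 | h0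
  · left
    rw [h0] at h1
    have h3 : Tendsto (fun j => (1 + ‖v (φ j) i‖)⁻¹) atTop (𝓝[>] 0) :=
      tendsto_nhdsWithin_iff.2 ⟨h1, Eventually.of_forall fun j => by
        have := norm_nonneg (v (φ j) i)
        exact Set.mem_Ioi.2 (by positivity)⟩
    have h4 := tendsto_inv_nhdsGT_zero.comp h3
    simp only [Function.comp_def, inv_inv] at h4
    simpa using tendsto_atTop_add_const_left _ (-1) h4
  · right
    refine ⟨(q i).2 / ((q i).1 : ℂ), ?_⟩
    refine (h2.div ((Complex.continuous_ofReal.tendsto _).comp h1)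
      (Complex.ofReal_ne_zero.2 h0)).congr fun j => ?_
    have : (((1 + ‖v (φ j) i‖)⁻¹ : ℝ) : ℂ) ≠ 0 := by
      have := norm_nonneg (v (φ j) i)
      exact Complex.ofReal_ne_zero.2 (by positivity)
    exact mul_div_cancel_left₀ _ this

open Metric Set in
/-- A locally uniform limit of holomorphic functions on an open subset of a finite-dimensional
complex normed space is holomorphic. -/
theorem TendstoLocallyUniformlyOn.differentiableOn_of_properSpace {E : Type*}
    [NormedAddCommGroup E] [NormedSpace ℂ E] [ProperSpace E] {w : ℕ → E → ℂ} {h : E → ℂ}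
    {U : Set E} (hU : IsOpen U) (hw : TendstoLocallyUniformlyOn w h atTop U)
    (hd : ∀ᶠ j in atTop, DifferentiableOn ℂ (w j) U) : DifferentiableOn ℂ h U := by
  obtain ⟨N, hN⟩ := eventually_atTop.1 hd
  intro x hx
  obtain ⟨ρ, hρ, hball⟩ := nhds_basis_closedBall.mem_iff.1 (hU.mem_nhds hx)
  have hunif : TendstoUniformlyOn w h atTop (closedBall x ρ) :=
    (tendstoLocallyUniformlyOn_iff_forall_isCompact hU).1 hw _ hball (isCompact_closedBall x ρ)
  have hunif' : TendstoUniformlyOn (fun j => w (j + N)) h atTop (closedBall x ρ) :=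
    fun s hs => (tendsto_add_atTop_nat N).eventually (hunif s hs)
  have hdiff : ∀ j, DifferentiableOn ℂ (w (j + N)) (ball x ρ) := fun j =>
    (hN _ (Nat.le_add_left N j)).mono (ball_subset_closedBall.trans hball)
  have hat : ∀ j, ∀ y ∈ ball x (ρ / 2), DifferentiableAt ℂ (w (j + N)) y := fun j y hy =>
    (hdiff j).differentiableAt (isOpen_ball.mem_nhds (ball_subset_ball (by linarith) hy))
  -- A Schwarz estimate on balls of radius ρ/2 bounds the difference of derivatives by (ερ/4)/(ρ/2)
  -- = ε/2.
  have hC : UniformCauchySeqOn (fun j => fderiv ℂ (w (j + N))) atTop (ball x (ρ / 2)) := by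
    rw [Metric.uniformCauchySeqOn_iff]
    intro ε hε
    obtain ⟨m, hm⟩ := Metric.uniformCauchySeqOn_iff.1 hunif'.uniformCauchySeqOn (ε * ρ / 8)
      (by positivity)
    refine ⟨m, fun j hj k hk z hz => ?_⟩
    have hsub : ball z (ρ / 2) ⊆ ball x ρ := ball_subset_ball' (by
      rw [mem_ball] at hz; linarith)
    have hb : ∀ y ∈ ball x ρ, ‖w (j + N) y - w (k + N) y‖ ≤ ε * ρ / 8 := fun y hy => by
      rw [← dist_eq_norm]; exact (hm j hj k hk y (ball_subset_closedBall hy)).le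
    have h1 := Complex.norm_fderiv_le_div_of_mapsTo_ball (R₂ := ε * ρ / 4)
      (((hdiff j).sub (hdiff k)).mono hsub) (c := z) (fun y hy => by
        rw [mem_closedBall, dist_eq_norm]
        refine (norm_sub_le _ _).trans ?_
        have e1 := hb y (hsub hy)
        have e2 := hb z (hsub (mem_ball_self (by positivity)))
        simp only [Pi.sub_apply]
        linarith) (by positivity)
    rw [fderiv_sub (hat j z hz) (hat k z hz), ← dist_eq_norm] at h1
    refine h1.trans_lt ?_
    rw [div_lt_iff₀ (by positivity)]
    nlinarith
  have hlim : ∀ z ∈ ball x (ρ / 2), ∃ l, Tendsto (fun j => fderiv ℂ (w (j + N)) z) atTop (𝓝 l) :=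
    fun z hz => cauchySeq_tendsto_of_complete (hC.cauchySeq hz)
  choose! g' hg' using hlim
  exact (hasFDerivAt_of_tendstoUniformlyOn isOpen_ball (hC.tendstoUniformlyOn_of_tendsto hg')
    (fun j y hy => (hat j y hy).hasFDerivAt)
    (fun y hy => hunif'.tendsto_at
      (ball_subset_closedBall (ball_subset_ball (by linarith) hy)))
    (mem_ball_self (by positivity))).differentiableAt.differentiableWithinAt

theorem chordalDist_coe_coe_le (a b : ℂ) :
    chordalDist (a : OnePoint ℂ) (b : OnePoint ℂ) ≤ ‖a - b‖ := by
  rw [chordalDist_coe_coe]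
  refine div_le_self (norm_nonneg _) (one_le_mul_of_one_le_of_one_le ?_ ?_) <;>
  · rw [Real.one_le_sqrt]
    nlinarith [norm_nonneg a, norm_nonneg b]

theorem chordalDist_coe_infty_lt {a : ℂ} {ε : ℝ} (hε : 0 < ε) (ha : ε⁻¹ < ‖a‖) :
    chordalDist (a : OnePoint ℂ) OnePoint.infty < ε := by
  rw [chordalDist_coe_infty, one_div]
  refine inv_lt_of_inv_lt₀ hε (ha.trans_le (Real.le_sqrt_of_sq_le ?_))
  linarith

open Metric Set in
/-- A locally bounded sequence of holomorphic functions that converges at the points of a dense set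
converges locally uniformly. -/
theorem exists_tendstoLocallyUniformlyOn_of_dense {E : Type*} [NormedAddCommGroup E]
    [NormedSpace ℂ E] {w : ℕ → E → ℂ} {U D : Set E} (hD : Dense D)
    (hw : ∀ j, DifferentiableOn ℂ (w j) U)
    (hb : ∀ x ∈ U, ∃ ρ > 0, ball x ρ ⊆ U ∧ ∃ M : ℝ, ∀ᶠ j in atTop, ∀ z ∈ ball x ρ, ‖w j z‖ ≤ M)
    (hlim : ∀ d ∈ D, d ∈ U → ∃ l, Tendsto (fun j => w j d) atTop (𝓝 l)) :
    ∃ h : E → ℂ, TendstoLocallyUniformlyOn w h atTop U := by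
  -- Schwarz's lemma yields a Lipschitz constant independent of j. The added 1 in it keeps it
  -- positive.
  have hlip : ∀ x ∈ U, ∃ ρ > 0, ball x ρ ⊆ U ∧ ∃ L > 0, ∀ᶠ j in atTop, ∀ z ∈ ball x ρ,
      dist (w j z) (w j x) ≤ L * dist z x := by
    intro x hx
    obtain ⟨ρ, hρ, hsub, M, hM⟩ := hb x hx
    refine ⟨ρ, hρ, hsub, (2 * |M| + 1) / ρ, by positivity, hM.mono fun j hj z hz => ?_⟩
    refine Complex.dist_le_div_mul_dist_of_mapsTo_ball ((hw j).mono hsub) (fun y hy => ?_) hz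
    rw [mem_closedBall, dist_eq_norm]
    linarith [norm_sub_le (w j y) (w j x), hj y hy, hj x (mem_ball_self hρ), le_abs_self M]
  have hpt : ∀ x ∈ U, ∃ l, Tendsto (fun j => w j x) atTop (𝓝 l) := by
    intro x hx
    obtain ⟨ρ, hρ, hsub, L, hL, hj⟩ := hlip x hx
    refine cauchySeq_tendsto_of_complete (Metric.cauchySeq_iff'.2 fun ε hε => ?_)
    obtain ⟨d, hdx, hd⟩ := hD.exists_dist_lt x (ε := min ρ (ε / (4 * L))) (by positivity)
    rw [lt_min_iff, dist_comm] at hd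
    obtain ⟨l, hl⟩ := hlim d hdx (hsub hd.1)
    obtain ⟨N₁, hN₁⟩ := eventually_atTop.1 hj
    obtain ⟨N₂, hN₂⟩ := Metric.cauchySeq_iff.1 hl.cauchySeq (ε / 2) (by positivity)
    have hLd : L * dist d x < ε / 4 := by
      rw [lt_div_iff₀ (by positivity)] at hd
      linarith
    refine ⟨max N₁ N₂, fun j hj => ?_⟩
    have h1 := hN₁ j ((le_max_left _ _).trans hj) d hd.1
    have h2 := hN₁ (max N₁ N₂) (le_max_left _ _) d hd.1
    have h3 := hN₂ j ((le_max_right _ _).trans hj) (max N₁ N₂) (le_max_right _ _)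
    have h4 := dist_triangle4 (w j x) (w j d) (w (max N₁ N₂) d) (w (max N₁ N₂) x)
    rw [dist_comm (w j x) (w j d)] at h4
    linarith
  choose! h hh using hpt
  refine ⟨h, Metric.tendstoLocallyUniformlyOn_iff.2 fun ε hε x hx => ?_⟩
  obtain ⟨ρ, hρ, hsub, L, hL, hj⟩ := hlip x hx
  have hhL : ∀ z ∈ ball x ρ, dist (h z) (h x) ≤ L * dist z x := fun z hz =>
    le_of_tendsto ((hh z (hsub hz)).dist (hh x hx)) (hj.mono fun j hj => hj z hz)
  refine ⟨ball x (min ρ (ε / (4 * L))),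
    mem_nhdsWithin_of_mem_nhds (ball_mem_nhds x (by positivity)), ?_⟩
  filter_upwards [hj, (Metric.tendsto_nhds.1 (hh x hx)) (ε / 2) (by positivity)] with j h1 h2 z hz
  rw [mem_ball, lt_min_iff] at hz
  have hLd : L * dist z x < ε / 4 := by
    rw [lt_div_iff₀ (by positivity)] at hz
    linarith
  have h3 := h1 z hz.1
  have h4 := hhL z hz.1
  have h5 := dist_triangle4 (h z) (h x) (w j x) (w j z)
  rw [dist_comm (h x), dist_comm (w j x) (w j z)] at h5
  linarith

/-! ### The dichotomy and Montel's theorem -/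

open Metric Set in
/-- If holomorphic functions omit two values, then convergence on a dense set, possibly to infinity,
forces each point to have a neighbourhood on which the functions tend to infinity uniformly or
are bounded. -/
theorem exists_ball_tendsto_atTop_or_bounded {E : Type*} [NormedAddCommGroup E]
    [NormedSpace ℂ E] {w : ℕ → E → ℂ} {U D : Set E} (hU : IsOpen U) (hD : Dense D)
    (hw : ∀ j, DifferentiableOn ℂ (w j) U) {a b : ℂ} (hab : a ≠ b)
    (hav : ∀ j, ∀ z ∈ U, w j z ≠ a ∧ w j z ≠ b)
    (hlim : ∀ d ∈ D, Tendsto (fun j => ‖w j d‖) atTop atTop ∨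
      ∃ l, Tendsto (fun j => w j d) atTop (𝓝 l)) {x : E} (hx : x ∈ U) :
    ∃ ρ > 0, ball x ρ ⊆ U ∧
      ((∀ R : ℝ, ∀ᶠ j in atTop, ∀ z ∈ ball x ρ, R < ‖w j z‖) ∨
        ∃ M : ℝ, ∀ᶠ j in atTop, ∀ z ∈ ball x ρ, ‖w j z‖ ≤ M) := by
  obtain ⟨ρ, hρ, hsub⟩ := Metric.isOpen_iff.1 hU x hx
  obtain ⟨d, hdD, hd⟩ := hD.exists_dist_lt x (ε := ρ / 8) (by positivity)
  have hdz : ∀ z ∈ ball x (ρ / 8), dist z d < ρ / 4 := fun z hz => by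
    rw [mem_ball] at hz
    linarith [dist_triangle z x d]
  refine ⟨ρ / 8, by positivity, (ball_subset_ball (by linarith)).trans hsub, ?_⟩
  refine (hlim d hdD).imp (fun h R => ?_) fun ⟨l, hl⟩ => ?_
  -- Schottky is centred at z here: a value at most R at z would bound the value at d by M. In the
  -- other case it is centred at d.
  · obtain ⟨M, hM⟩ := exists_norm_le_of_ne_of_ne (E := E) hab R
    filter_upwards [h.eventually_gt_atTop M] with j hj z hz
    by_contra! hR
    have hzs : ball z (ρ / 2) ⊆ U := (ball_subset_ball' (by
      rw [mem_ball] at hz; linarith)).trans hsub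
    refine hj.not_ge (hM z (ρ / 2) (w j) ((hw j).mono hzs) (fun y hy => hav j y (hzs hy)) hR d ?_)
    rw [mem_ball']
    linarith [hdz z hz]
  · obtain ⟨M, hM⟩ := exists_norm_le_of_ne_of_ne (E := E) hab (‖l‖ + 1)
    refine ⟨M, ?_⟩
    filter_upwards [hl.norm.eventually_lt_const (lt_add_one ‖l‖)] with j hj z hz
    have hds : ball d (ρ / 2) ⊆ U := (ball_subset_ball' (by
      rw [dist_comm]; linarith)).trans hsub
    refine hM d (ρ / 2) (w j) ((hw j).mono hds) (fun y hy => hav j y (hds hy)) hj.le z ?_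
    rw [mem_ball]
    linarith [hdz z hz]

/-- Finitely many of the local neighbourhoods cover a compact set. -/
theorem chordallyTendstoOnCompacts_of_local {X : Type*} [TopologicalSpace X] {Ω : Set X}
    {u : ℕ → X → ℂ} {g : X → OnePoint ℂ}
    (h : ∀ x ∈ Ω, ∀ ε : ℝ, 0 < ε → ∃ V ∈ 𝓝[Ω] x, ∀ᶠ j in atTop, ∀ z ∈ V,
      chordalDist (u j z : OnePoint ℂ) (g z) < ε) : ChordallyTendstoOnCompacts Ω u g := by
  intro K hK hKc ε hε
  refine hKc.induction_on (p := fun s => ∀ᶠ j in atTop, ∀ z ∈ s,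
    chordalDist (u j z : OnePoint ℂ) (g z) < ε) (by simp)
    (fun s t hst ht => ht.mono fun j hj z hz => hj z (hst hz))
    (fun s t hs ht => ?_) fun x hx => ?_
  · filter_upwards [hs, ht] with j hj₁ hj₂ z hz
    exact hz.elim (hj₁ z) (hj₂ z)
  · obtain ⟨V, hV, hj⟩ := h x (hK hx) ε hε
    exact ⟨V, nhdsWithin_mono x hK hV, hj⟩

open Metric Set in
/-- **Montel's theorem** on finite-dimensional complex normed spaces. -/
theorem exists_subseq_chordallyTendstoOnCompacts {E : Type*} [NormedAddCommGroup E]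
    [NormedSpace ℂ E] [ProperSpace E] {Ω : Set E} (hΩ : IsOpen Ω) {u : ℕ → E → ℂ}
    (hu : ∀ j, DifferentiableOn ℂ (u j) Ω) {a b : ℂ} (hab : a ≠ b)
    (hav : ∀ j, ∀ z ∈ Ω, u j z ≠ a ∧ u j z ≠ b) :
    ∃ φ : ℕ → ℕ, StrictMono φ ∧ ∃ g : E → OnePoint ℂ,
      ChordallyTendstoOnCompacts Ω (fun j => u (φ j)) g ∧
      ∀ x ∈ Ω, (∀ z ∈ connectedComponentIn Ω x, g z = OnePoint.infty) ∨
        (∃ h : E → ℂ, DifferentiableOn ℂ h (connectedComponentIn Ω x) ∧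
          (∀ z ∈ connectedComponentIn Ω x, g z = (h z : OnePoint ℂ)) ∧
          ∀ K : Set E, K ⊆ connectedComponentIn Ω x → IsCompact K →
            TendstoUniformlyOn (fun j => u (φ j)) h atTop K) := by
  classical
  obtain ⟨D, hDc, hD⟩ := TopologicalSpace.exists_countable_dense E
  have := hDc.to_subtype
  obtain ⟨φ, hφ, hlim⟩ := exists_subseq_tendsto_norm_atTop_or_tendsto fun j (d : D) => u j d
  set w : ℕ → E → ℂ := fun j => u (φ j) with hwdef
  have hlim' : ∀ d ∈ D, Tendsto (fun j => ‖w j d‖) atTop atTop ∨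
      ∃ l, Tendsto (fun j => w j d) atTop (𝓝 l) := fun d hd => hlim ⟨d, hd⟩
  let A : Set E := {x | ∃ ρ > 0, ball x ρ ⊆ Ω ∧
    ∀ R : ℝ, ∀ᶠ j in atTop, ∀ z ∈ ball x ρ, R < ‖w j z‖}
  let B : Set E := {x | ∃ ρ > 0, ball x ρ ⊆ Ω ∧
    ∃ M : ℝ, ∀ᶠ j in atTop, ∀ z ∈ ball x ρ, ‖w j z‖ ≤ M}
  have hcover : ∀ x ∈ Ω, x ∈ A ∨ x ∈ B := by
    intro x hx
    obtain ⟨ρ, hρ, hsub, h⟩ := exists_ball_tendsto_atTop_or_bounded hΩ hD (fun j => hu (φ j)) hab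
      (fun j => hav (φ j)) hlim' hx
    exact h.imp (fun h => ⟨ρ, hρ, hsub, h⟩) fun h => ⟨ρ, hρ, hsub, h⟩
  have hAball : ∀ x ∈ A, ∃ ρ > 0, ball x ρ ⊆ A ∧
      ∀ R : ℝ, ∀ᶠ j in atTop, ∀ z ∈ ball x ρ, R < ‖w j z‖ := by
    rintro x ⟨ρ, hρ, hsub, h⟩
    refine ⟨ρ, hρ, fun y hy => ?_, h⟩
    obtain ⟨δ, hδ, hyδ⟩ := Metric.isOpen_iff.1 isOpen_ball y hy
    exact ⟨δ, hδ, hyδ.trans hsub, fun R => (h R).mono fun j hj z hz => hj z (hyδ hz)⟩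
  have hBball : ∀ x ∈ B, ∃ ρ > 0, ball x ρ ⊆ B ∧
      ∃ M : ℝ, ∀ᶠ j in atTop, ∀ z ∈ ball x ρ, ‖w j z‖ ≤ M := by
    rintro x ⟨ρ, hρ, hsub, M, h⟩
    refine ⟨ρ, hρ, fun y hy => ?_, M, h⟩
    obtain ⟨δ, hδ, hyδ⟩ := Metric.isOpen_iff.1 isOpen_ball y hy
    exact ⟨δ, hδ, hyδ.trans hsub, M, h.mono fun j hj z hz => hj z (hyδ hz)⟩
  have hAo : IsOpen A := Metric.isOpen_iff.2 fun x hx =>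
    let ⟨ρ, hρ, h, _⟩ := hAball x hx; ⟨ρ, hρ, h⟩
  have hBo : IsOpen B := Metric.isOpen_iff.2 fun x hx =>
    let ⟨ρ, hρ, h, _⟩ := hBball x hx; ⟨ρ, hρ, h⟩
  have hBΩ : B ⊆ Ω := fun x ⟨ρ, hρ, h, _⟩ => h (mem_ball_self hρ)
  have hAB : Disjoint A B := by
    rw [Set.disjoint_left]
    rintro x ⟨ρ, hρ, -, h⟩ ⟨σ, hσ, -, M, hM⟩
    obtain ⟨j, hj₁, hj₂⟩ := ((h M).and hM).exists
    exact (hj₁ x (mem_ball_self hρ)).not_ge (hj₂ x (mem_ball_self hσ))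
  have hwB : ∀ j, DifferentiableOn ℂ (w j) B := fun j => (hu (φ j)).mono hBΩ
  -- At dense points in B, local boundedness rules out divergence to ∞.
  obtain ⟨h, hh⟩ := exists_tendstoLocallyUniformlyOn_of_dense hD hwB hBball fun d hd hdB => by
    refine (hlim' d hd).resolve_left fun hinf => ?_
    obtain ⟨ρ, hρ, -, M, hM⟩ := hdB
    obtain ⟨j, hj₁, hj₂⟩ := ((hinf.eventually_gt_atTop M).and hM).exists
    exact hj₁.not_ge (hj₂ d (mem_ball_self hρ))
  refine ⟨φ, hφ, fun z => if z ∈ A then OnePoint.infty else (h z : OnePoint ℂ), ?_, ?_⟩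
  · refine chordallyTendstoOnCompacts_of_local fun x hx ε hε => ?_
    rcases hcover x hx with hxA | hxB
    · obtain ⟨ρ, hρ, hsub, hR⟩ := hAball x hxA
      refine ⟨ball x ρ, mem_nhdsWithin_of_mem_nhds (ball_mem_nhds x hρ), ?_⟩
      filter_upwards [hR ε⁻¹] with j hj z hz
      rw [if_pos (hsub hz)]
      exact chordalDist_coe_infty_lt hε (hj z hz)
    · obtain ⟨V, hV, hj⟩ := Metric.tendstoLocallyUniformlyOn_iff.1 hh ε hε x hxB
      rw [hBo.nhdsWithin_eq hxB] at hV
      refine ⟨V ∩ B, mem_nhdsWithin_of_mem_nhds (inter_mem hV (hBo.mem_nhds hxB)), ?_⟩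
      filter_upwards [hj] with j hj z hz
      rw [if_neg (hAB.notMem_of_mem_right hz.2)]
      refine (chordalDist_coe_coe_le _ _).trans_lt ?_
      rw [← dist_eq_norm, dist_comm]
      exact hj z hz.1
  · intro x hx
    rcases isPreconnected_connectedComponentIn.subset_or_subset hAo hBo hAB
      ((connectedComponentIn_subset Ω x).trans hcover) with hC | hC
    · exact Or.inl fun z hz => if_pos (hC hz)
    · refine Or.inr ⟨h, (hh.differentiableOn_of_properSpace hBo (Eventually.of_forall hwB)).mono hC,
        fun z hz => if_neg (hAB.notMem_of_mem_right (hC hz)), fun K hK hKc => ?_⟩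
      exact (tendstoLocallyUniformlyOn_iff_forall_isCompact hBo).1 hh K (hK.trans hC) hKc

theorem mainTheorem1 (n : ℕ) (Ω : Set (EuclideanSpace ℂ (Fin n))) (hΩ : IsOpen Ω)
    (F : Set (EuclideanSpace ℂ (Fin n) → ℂ))
    (hF : ∀ f ∈ F, DifferentiableOn ℂ f Ω)
    (a b : ℂ) (hab : a ≠ b)
    (hF_avoid : ∀ f ∈ F, ∀ z ∈ Ω, f z ≠ a ∧ f z ≠ b)
    (u : ℕ → EuclideanSpace ℂ (Fin n) → ℂ) (hu : ∀ j, u j ∈ F) :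
    ∃ φ : ℕ → ℕ, StrictMono φ ∧
      ∃ g : EuclideanSpace ℂ (Fin n) → OnePoint ℂ,
        ChordallyTendstoOnCompacts Ω (fun j => u (φ j)) g ∧
        -- on each connected component of `Ω`, the limit is identically `∞`, or it is holomorphic
        -- and the convergence is locally uniform in the ordinary sense
        ∀ x ∈ Ω,
          (∀ z ∈ connectedComponentIn Ω x, g z = OnePoint.infty) ∨
          (∃ h : EuclideanSpace ℂ (Fin n) → ℂ,
            DifferentiableOn ℂ h (connectedComponentIn Ω x) ∧
            (∀ z ∈ connectedComponentIn Ω x, g z = (h z : OnePoint ℂ)) ∧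
            ∀ K : Set (EuclideanSpace ℂ (Fin n)), K ⊆ connectedComponentIn Ω x → IsCompact K →
              TendstoUniformlyOn (fun j => u (φ j)) h atTop K) :=
  exists_subseq_chordallyTendstoOnCompacts hΩ (fun j => hF _ (hu j)) hab
    fun j => hF_avoid _ (hu j)
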